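/- Let $R$ be an integral domain with quotient field $L$. Let $F(R)$ be the set of nonzero fractional ideals of $R$. A \emph{star operation} on $R$ is a map $F(R)\to F(R)$, $E\mapsto E^{*}$, such that for all $a\in L\setminus\{0\}$ and $E,F\in F(R)$: (I) $R^{*}=R$ and $(aE)^{*}=aE^{*}$; (II) $E\subseteq E^{*}$, and $E\subseteq F$ implies $E^{*}\subseteq F^{*}$; (III) $(E^{*})^{*}=E^{*}$. It is \emph{of finite type} if for every $E\in F(R)$ one has $E^{*}=\bigcup F^{*}$, the union being over all nonzero finitely generated fractional ideals $F\subseteq E$ of $R$. Let $\mathrm{StarFC}(R)$ be the set of star operations of finite type on $R$, and let $|\mathrm{StarFC}(R)|\in\mathbb{N}\cup\{\infty\}$ be its number of elements (infinite cardinalities are not distinguished). The domain $R$ is \emph{finitely star regular} if $|\mathrm{StarFC}(T)|\le|\mathrm{StarFC}(R)|$ for every overring $T$ of $R$, i.e. every ring $T$ with $R\subseteq T\subseteq L$. The domain $R$ is a \emph{pseudo-valuation domain} if it is quasilocal (it has a unique maximal ideal) and there is a valuation domain $V$ with quotient field $L$ whose maximal ideal is equal to the maximal ideal of $R$. \textbf{Theorem.}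 Every pseudo-valuation domain is finitely star regular. -/

import Mathlib

open scoped nonZeroDivisors

/-- The set `F(R)` of nonzero fractional ideals of `R` (with fraction field `L`),
partially ordered by inclusion. -/
abbrev NonzeroFractionalIdeal (R L : Type*) [CommRing R] [Field L] [Algebra R L] : Type _ :=
  {E : FractionalIdeal R⁰ L // E ≠ 0}

namespace NonzeroFractionalIdeal

variable {R L : Type*} [CommRing R] [IsDomain R] [Field L] [Algebra R L] [IsFractionRing R L]

/-- The ring `R` itself, as a nonzero fractional ideal. -/
def unit : NonzeroFractionalIdeal R L := ⟨1, one_ne_zero⟩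

/-- The fractional ideal `aE`, for a nonzero `a` in the fraction field. -/
noncomputable def scale (a : L) (ha : a ≠ 0) (E : NonzeroFractionalIdeal R L) :
    NonzeroFractionalIdeal R L :=
  ⟨FractionalIdeal.spanSingleton R⁰ a * E.1, by
    intro h
    apply E.2
    have h1 : FractionalIdeal.spanSingleton R⁰ a⁻¹ *
        (FractionalIdeal.spanSingleton R⁰ a * E.1) = E.1 := by
      rw [← mul_assoc, FractionalIdeal.spanSingleton_mul_spanSingleton, inv_mul_cancel₀ ha,
        FractionalIdeal.spanSingleton_one, one_mul]
    rw [← h1, h, mul_zero]⟩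

/-- `E` is finitely generated as an `R`-module. -/
def FG (E : NonzeroFractionalIdeal R L) : Prop := (E.1 : Submodule R L).FG

end NonzeroFractionalIdeal

/-- A star operation on the domain `R` with fraction field `L`: a self-map `E ↦ E^*` of `F(R)`
that fixes `R`, commutes with multiplication by nonzero elements of `L`, and is extensive,
monotone and idempotent. -/
@[ext]
structure StarOperation (R L : Type*) [CommRing R] [IsDomain R] [Field L] [Algebra R L]
    [IsFractionRing R L] where
  toFun : NonzeroFractionalIdeal R L → NonzeroFractionalIdeal R L
  map_unit : toFun NonzeroFractionalIdeal.unit = NonzeroFractionalIdeal.unit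
  map_scale : ∀ (a : L) (ha : a ≠ 0) (E : NonzeroFractionalIdeal R L),
    toFun (E.scale a ha) = (toFun E).scale a ha
  le_map : ∀ E, E ≤ toFun E
  mono : ∀ E F, E ≤ F → toFun E ≤ toFun F
  idem : ∀ E, toFun (toFun E) = toFun E

/-- `*` is of finite type: `E^*` is the union of the `F^*`, where `F` runs over the nonzero
finitely generated fractional ideals contained in `E`. -/
def StarOperation.IsFiniteType {R L : Type*} [CommRing R] [IsDomain R] [Field L] [Algebra R L]
    [IsFractionRing R L] (s : StarOperation R L) : Prop :=
  ∀ (E : NonzeroFractionalIdeal R L) (x : L),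
    x ∈ (s.toFun E).1 ↔ ∃ F : NonzeroFractionalIdeal R L, F.FG ∧ F ≤ E ∧ x ∈ (s.toFun F).1

/-- The set of star operations of finite type on `R`. -/
def StarFC (R L : Type*) [CommRing R] [IsDomain R] [Field L] [Algebra R L]
    [IsFractionRing R L] : Set (StarOperation R L) :=
  {s | s.IsFiniteType}

/-- `R` is finitely star regular: `|StarFC(T)| ≤ |StarFC(R)|` for every ring `T` with
`R ⊆ T ⊆ L`. Numbers of star operations are counted in `ℕ ∪ {∞}`. -/
def IsFinitelyStarRegular (R L : Type*) [CommRing R] [IsDomain R] [Field L] [Algebra R L]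
    [IsFractionRing R L] : Prop :=
  ∀ T : Subalgebra R L, (StarFC T L).encard ≤ (StarFC R L).encard

/-- `R` is a pseudo-valuation domain: `R` is quasilocal and there is a valuation ring `V` of its
fraction field `L` such that `R` and `V` have the same maximal ideal, as subsets of `L`
(it follows that `V` contains `R`). -/
def IsPseudoValuationDomain (R L : Type*) [CommRing R] [IsDomain R] [Field L] [Algebra R L]
    [IsFractionRing R L] : Prop :=
  ∃ (_ : IsLocalRing R) (V : ValuationSubring L),
    algebraMap R L '' (IsLocalRing.maximalIdeal R : Set R) =
      ((↑) : V → L) '' (IsLocalRing.maximalIdeal V : Set V)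

/-!
Let `V` be the valuation ring that shares its maximal ideal `M` with the pseudo-valuation domain
`R`, and let `T` be an overring of `R`.

If `T` contains `V`, then `T` is a valuation ring, its finitely generated fractional ideals are
principal, and the identity is its only star operation of finite type
(`starFC_subsingleton_of_valuationSubring_le`); the identity is also one on `R`.

Otherwise a star operation `*` on `T` is contracted to `R`: `E` is sent to the union of
`(FT)^* ∩ F_v` over the finitely generated `F ⊆ E`, where `F_v` is the intersection of the principal
fractional ideals of `R` containing `F`. This is a star operation of finite type for every domain
and every overring (`StarOperation.contract`). It remains to see that `*` can be recovered from it
(`contract_injOn_of_not_valuationSubring_le`).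

It is enough to recover `J^*` for finitely generated `J`. One of the generators of `J`, say `a`, has
the largest value, so that `J ⊆ aV`; and `J^* ⊆ aV` because `V = (T : M)` is divisorial over `T`
(`StarOperation.exists_eq_mul_of_mem`). If `T ≠ R`, choose `y ∈ T` outside `R`, and let `G` be
generated over `R` by the generators of `J` and `ya`. Then `GT = J`. If `G ⊆ zR`, then `a/z` and
`ya/z` lie in `R`, so `a/z` is not a unit of `R` and lies in `M`, whence `aV ⊆ zM ⊆ zR`. Thus
`J^* ⊆ aV ⊆ G_v`, and the contracted operation sends `G` to `(GT)^* ∩ G_v = J^*`. If `T = R`, the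
inclusion `J^* ⊆ J_v` holds for every star operation.
-/

set_option linter.unusedSectionVars false

/-! ### Nonzero fractional ideals -/

namespace NonzeroFractionalIdeal

variable {R L : Type*} [CommRing R] [IsDomain R] [Field L] [Algebra R L] [IsFractionRing R L]

theorem exists_mem_ne_zero (E : NonzeroFractionalIdeal R L) : ∃ x ∈ E.1, x ≠ 0 := by
  by_contra! h
  exact E.2 (FractionalIdeal.eq_zero_iff.2 h)

theorem mem_scale {a : L} {ha : a ≠ 0} {E : NonzeroFractionalIdeal R L} {x : L} :
    x ∈ (E.scale a ha).1 ↔ ∃ y ∈ E.1, x = a * y :=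
  FractionalIdeal.mem_singleton_mul

theorem mem_unit_scale {a : L} {ha : a ≠ 0} {x : L} :
    x ∈ ((unit : NonzeroFractionalIdeal R L).scale a ha).1 ↔ ∃ r : R, x = a * algebraMap R L r := by
  rw [mem_scale]
  constructor
  · rintro ⟨y, hy, rfl⟩
    obtain ⟨r, rfl⟩ := (FractionalIdeal.mem_one_iff _).1 hy
    exact ⟨r, rfl⟩
  · rintro ⟨r, rfl⟩
    exact ⟨_, (FractionalIdeal.mem_one_iff _).2 ⟨r, rfl⟩, rfl⟩

theorem scale_mono {a : L} (ha : a ≠ 0) {E F : NonzeroFractionalIdeal R L} (h : E ≤ F) :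
    E.scale a ha ≤ F.scale a ha := by
  intro x hx
  obtain ⟨y, hy, rfl⟩ := mem_scale.1 hx
  exact mem_scale.2 ⟨y, h hy, rfl⟩

theorem scale_scale {a b : L} (ha : a ≠ 0) (hb : b ≠ 0) (E : NonzeroFractionalIdeal R L) :
    (E.scale b hb).scale a ha = E.scale (a * b) (mul_ne_zero ha hb) := by
  apply Subtype.ext
  simp only [scale]
  rw [← mul_assoc, FractionalIdeal.spanSingleton_mul_spanSingleton]

theorem scale_one (E : NonzeroFractionalIdeal R L) : E.scale 1 one_ne_zero = E := by
  apply Subtype.ext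
  simp [scale]

theorem scale_inv_scale {a : L} (ha : a ≠ 0) (E : NonzeroFractionalIdeal R L) :
    (E.scale a ha).scale a⁻¹ (inv_ne_zero ha) = E := by
  rw [scale_scale]
  simp only [inv_mul_cancel₀ ha, scale_one]

theorem scale_scale_inv {a : L} (ha : a ≠ 0) (E : NonzeroFractionalIdeal R L) :
    (E.scale a⁻¹ (inv_ne_zero ha)).scale a ha = E := by
  rw [scale_scale]
  simp only [mul_inv_cancel₀ ha, scale_one]

theorem FG.scale {E : NonzeroFractionalIdeal R L} (h : E.FG) (a : L) (ha : a ≠ 0) :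
    (E.scale a ha).FG := by
  unfold NonzeroFractionalIdeal.FG NonzeroFractionalIdeal.scale
  rw [FractionalIdeal.coe_mul, FractionalIdeal.coe_spanSingleton]
  exact (Submodule.fg_span_singleton a).mul h

/-- Every fractional ideal lies in a principal one. -/
theorem exists_le_unit_scale (E : NonzeroFractionalIdeal R L) :
    ∃ (a : L) (ha : a ≠ 0), E ≤ unit.scale a ha := by
  obtain ⟨r, hr, h⟩ := FractionalIdeal.isFractional E.1
  have hr0 : algebraMap R L r ≠ 0 := IsFractionRing.to_map_ne_zero_of_mem_nonZeroDivisors hr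
  refine ⟨(algebraMap R L r)⁻¹, inv_ne_zero hr0, fun x hx => ?_⟩
  obtain ⟨t, ht⟩ := h x hx
  refine mem_unit_scale.2 ⟨t, ?_⟩
  rw [ht, Algebra.smul_def, inv_mul_cancel_left₀ hr0]

/-- The nonzero fractional ideal with a given underlying submodule that is nonzero and finitely
generated. -/
def ofFG (N : Submodule R L) (hN : N.FG) (h : ∃ x ∈ N, x ≠ 0) : NonzeroFractionalIdeal R L :=
  ⟨⟨N, FractionalIdeal.isFractional_of_fg hN⟩, fun h0 => by
    obtain ⟨x, hx, hx0⟩ := h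
    exact hx0 (FractionalIdeal.eq_zero_iff.1 h0 x hx)⟩

theorem fg_ofFG (N : Submodule R L) (hN : N.FG) (h : ∃ x ∈ N, x ≠ 0) : (ofFG N hN h).FG := hN

/-- Every element of `E` lies in a nonzero finitely generated fractional ideal inside `E`; the
element itself may be `0`, which is why a nonzero element is adjoined to it. -/
theorem exists_fg_le_mem (E : NonzeroFractionalIdeal R L) {x : L} (hx : x ∈ E.1) :
    ∃ F : NonzeroFractionalIdeal R L, F.FG ∧ F ≤ E ∧ x ∈ F.1 := by
  obtain ⟨y, hy, hy0⟩ := E.exists_mem_ne_zero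
  have hle : Submodule.span R {x, y} ≤ (E.1 : Submodule R L) :=
    Submodule.span_le.2 (by rintro z (rfl | rfl) <;> assumption)
  exact ⟨ofFG (Submodule.span R {x, y}) (Submodule.fg_span (Set.toFinite _))
    ⟨y, Submodule.subset_span (by simp), hy0⟩, fg_ofFG _ _ _, hle,
    Submodule.subset_span (by simp)⟩

theorem exists_fg_sup {E F G : NonzeroFractionalIdeal R L} (hF : F.FG) (hG : G.FG)
    (hFE : F ≤ E) (hGE : G ≤ E) :
    ∃ H : NonzeroFractionalIdeal R L, H.FG ∧ H ≤ E ∧ F ≤ H ∧ G ≤ H := by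
  obtain ⟨y, hy, hy0⟩ := F.exists_mem_ne_zero
  exact ⟨ofFG ((F.1 : Submodule R L) ⊔ (G.1 : Submodule R L)) (Submodule.FG.sup hF hG)
    ⟨y, Submodule.mem_sup_left hy, hy0⟩, fg_ofFG _ _ _,
    sup_le (a := (F.1 : Submodule R L)) (b := (G.1 : Submodule R L)) (c := (E.1 : Submodule R L))
      hFE hGE,
    le_sup_left (a := (F.1 : Submodule R L)) (b := (G.1 : Submodule R L)),
    le_sup_right (a := (F.1 : Submodule R L)) (b := (G.1 : Submodule R L))⟩

variable (T : Type*) [CommRing T] [IsDomain T] [Algebra T L] [IsFractionRing T L]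
  [Algebra R T] [IsScalarTower R T L]

/-- The extension `ET` of a fractional ideal `E` of `R` to an overring `T` of `R`. -/
def extend (E : NonzeroFractionalIdeal R L) : NonzeroFractionalIdeal T L :=
  ⟨⟨Submodule.span T (E.1 : Set L), by
    obtain ⟨r, hr, h⟩ := FractionalIdeal.isFractional E.1
    have hr0 : algebraMap R L r ≠ 0 := IsFractionRing.to_map_ne_zero_of_mem_nonZeroDivisors hr
    refine ⟨algebraMap R T r, mem_nonZeroDivisors_of_ne_zero fun h0 => hr0 ?_, fun x hx => ?_⟩
    · rw [IsScalarTower.algebraMap_apply R T L, h0, map_zero]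
    · induction hx using Submodule.span_induction with
      | mem x hx =>
        obtain ⟨t, ht⟩ := h x hx
        exact ⟨algebraMap R T t, by
          rw [← IsScalarTower.algebraMap_apply R T L, ht, algebraMap_smul]⟩
      | zero => rw [smul_zero]; exact IsLocalization.isInteger_zero
      | add x y _ _ hx hy => rw [smul_add]; exact IsLocalization.isInteger_add hx hy
      | smul t x _ hx => rw [smul_comm]; exact IsLocalization.isInteger_smul hx⟩, fun h0 => by
    obtain ⟨x, hx, hx0⟩ := E.exists_mem_ne_zero
    exact hx0 (FractionalIdeal.eq_zero_iff.1 h0 x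
      (Submodule.subset_span (s := (E.1 : Set L)) hx))⟩

variable {T}

theorem mem_extend_of_mem {E : NonzeroFractionalIdeal R L} {x : L} (hx : x ∈ E.1) :
    x ∈ (E.extend T).1 :=
  Submodule.subset_span (s := (E.1 : Set L)) hx

theorem extend_le_iff {E : NonzeroFractionalIdeal R L} {J : NonzeroFractionalIdeal T L} :
    E.extend T ≤ J ↔ ∀ x ∈ E.1, x ∈ J.1 :=
  Submodule.span_le (s := (E.1 : Set L)) (p := (J.1 : Submodule T L))

theorem extend_mono {E F : NonzeroFractionalIdeal R L} (h : E ≤ F) : E.extend T ≤ F.extend T :=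
  extend_le_iff.2 fun _ hx => mem_extend_of_mem (h hx)

theorem extend_scale_le {a : L} (ha : a ≠ 0) (E : NonzeroFractionalIdeal R L) :
    (E.extend T).scale a ha ≤ (E.scale a ha).extend T := by
  have h : E.extend T ≤ ((E.scale a ha).extend T).scale a⁻¹ (inv_ne_zero ha) :=
    extend_le_iff.2 fun x hx => mem_scale.2
      ⟨a * x, mem_extend_of_mem (mem_scale.2 ⟨x, hx, rfl⟩), by rw [inv_mul_cancel_left₀ ha]⟩
  have := scale_mono ha h
  rwa [scale_scale_inv] at this

end NonzeroFractionalIdeal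

/-! ### Star operations of finite type -/

namespace StarOperation

open NonzeroFractionalIdeal

variable {R L : Type*} [CommRing R] [IsDomain R] [Field L] [Algebra R L] [IsFractionRing R L]

theorem map_unit_scale (s : StarOperation R L) (a : L) (ha : a ≠ 0) :
    s.toFun (unit.scale a ha) = unit.scale a ha := by
  rw [s.map_scale, s.map_unit]

theorem map_le_unit_scale (s : StarOperation R L) {a : L} {ha : a ≠ 0}
    {E : NonzeroFractionalIdeal R L} (h : E ≤ unit.scale a ha) : s.toFun E ≤ unit.scale a ha :=
  (s.mono _ _ h).trans_eq (s.map_unit_scale a ha)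

/-- A star operation of finite type is determined by its values on finitely generated fractional
ideals. -/
theorem IsFiniteType.ext_fg {s t : StarOperation R L} (hs : s.IsFiniteType) (ht : t.IsFiniteType)
    (hst : ∀ F : NonzeroFractionalIdeal R L, F.FG → s.toFun F ≤ t.toFun F)
    (hts : ∀ F : NonzeroFractionalIdeal R L, F.FG → t.toFun F ≤ s.toFun F) : s = t := by
  ext E x
  rw [hs, ht]
  exact ⟨fun ⟨F, h1, h2, h3⟩ => ⟨F, h1, h2, hst F h1 h3⟩,
    fun ⟨F, h1, h2, h3⟩ => ⟨F, h1, h2, hts F h1 h3⟩⟩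

variable (R L) in
theorem starFC_nonempty : (StarFC R L).Nonempty :=
  ⟨⟨id, rfl, fun _ _ _ => rfl, fun _ => le_rfl, fun _ _ h => h, fun _ => rfl⟩, fun E _ =>
    ⟨fun hx => E.exists_fg_le_mem hx, fun ⟨_, _, h2, h3⟩ => h2 h3⟩⟩

/-- If every finitely generated fractional ideal is principal, there is at most one star operation
of finite type. -/
theorem starFC_subsingleton
    (h : ∀ F : NonzeroFractionalIdeal R L, F.FG → ∃ (a : L) (ha : a ≠ 0), F = unit.scale a ha) :
    (StarFC R L).Subsingleton := by
  have key (s t : StarOperation R L) (F : NonzeroFractionalIdeal R L) (hF : F.FG) :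
      s.toFun F ≤ t.toFun F := by
    obtain ⟨a, ha, rfl⟩ := h F hF
    rw [map_unit_scale, map_unit_scale]
  exact fun s hs t ht => hs.ext_fg ht (key s t) (key t s)

/-! ### Contraction of a star operation along an overring -/

variable {T : Type*} [CommRing T] [IsDomain T] [Algebra T L] [IsFractionRing T L]
  [Algebra R T] [IsScalarTower R T L]

/-- `x` lies in `(FT)^*` and in every principal fractional ideal of `R` that contains `F`, that is,
in `(FT)^* ∩ F_v`. -/
def ContractRel (s : StarOperation T L) (F : NonzeroFractionalIdeal R L) (x : L) : Prop :=
  x ∈ (s.toFun (F.extend T)).1 ∧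
    ∀ (z : L) (hz : z ≠ 0), F ≤ unit.scale z hz →
      x ∈ (unit.scale z hz : NonzeroFractionalIdeal R L).1

theorem ContractRel.mono {s : StarOperation T L} {F G : NonzeroFractionalIdeal R L} {x : L}
    (h : s.ContractRel F x) (hFG : F ≤ G) : s.ContractRel G x :=
  ⟨s.mono _ _ (extend_mono hFG) h.1, fun z hz hG => h.2 z hz (hFG.trans hG)⟩

theorem contractRel_of_mem (s : StarOperation T L) {F : NonzeroFractionalIdeal R L} {x : L}
    (h : x ∈ F.1) : s.ContractRel F x :=
  ⟨s.le_map _ (mem_extend_of_mem h), fun _ _ hF => hF h⟩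

/-- The union of `(FT)^* ∩ F_v` over the finitely generated `F ⊆ E`, as a fractional ideal. -/
def contractFun (s : StarOperation T L) (E : NonzeroFractionalIdeal R L) :
    NonzeroFractionalIdeal R L :=
  ⟨⟨{ carrier := {x | ∃ F : NonzeroFractionalIdeal R L, F.FG ∧ F ≤ E ∧ s.ContractRel F x}
      add_mem' := by
        rintro x y ⟨F, hF, hFE, hx⟩ ⟨G, hG, hGE, hy⟩
        obtain ⟨H, hH, hHE, hFH, hGH⟩ := exists_fg_sup hF hG hFE hGE
        have hx := hx.mono hFH
        have hy := hy.mono hGH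
        exact ⟨H, hH, hHE, Submodule.add_mem (s.toFun (H.extend T)).1.1 hx.1 hy.1, fun z hz h =>
          Submodule.add_mem (unit.scale z hz : NonzeroFractionalIdeal R L).1.1
            (hx.2 z hz h) (hy.2 z hz h)⟩
      zero_mem' := by
        obtain ⟨F, hF, hFE, hx⟩ := E.exists_fg_le_mem (Submodule.zero_mem E.1.1)
        exact ⟨F, hF, hFE, s.contractRel_of_mem hx⟩
      smul_mem' := by
        rintro r x ⟨F, hF, hFE, hx⟩
        refine ⟨F, hF, hFE, ?_, fun z hz h =>
          Submodule.smul_mem (unit.scale z hz : NonzeroFractionalIdeal R L).1.1 r (hx.2 z hz h)⟩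
        rw [← algebraMap_smul T r x]
        exact Submodule.smul_mem (s.toFun (F.extend T)).1.1 _ hx.1 }, by
    obtain ⟨a, ha, hE⟩ := E.exists_le_unit_scale
    refine FractionalIdeal.isFractional_of_le
      (J := (unit.scale a ha : NonzeroFractionalIdeal R L).1) ?_
    rintro x ⟨F, hF, hFE, hx⟩
    exact hx.2 a ha (hFE.trans hE)⟩, fun h0 => by
    obtain ⟨x, hx, hx0⟩ := E.exists_mem_ne_zero
    obtain ⟨F, hF, hFE, hxF⟩ := E.exists_fg_le_mem hx
    exact hx0 (FractionalIdeal.eq_zero_iff.1 h0 x ⟨F, hF, hFE, s.contractRel_of_mem hxF⟩)⟩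

theorem mem_contractFun_of_fg {s : StarOperation T L} {E : NonzeroFractionalIdeal R L}
    (hE : E.FG) {x : L} : x ∈ (s.contractFun E).1 ↔ s.ContractRel E x :=
  ⟨fun ⟨_, _, h, hx⟩ => hx.mono h, fun hx => ⟨E, hE, le_rfl, hx⟩⟩

theorem contractFun_mono (s : StarOperation T L) {E F : NonzeroFractionalIdeal R L} (h : E ≤ F) :
    s.contractFun E ≤ s.contractFun F := fun _ ⟨G, hG, hGE, hx⟩ => ⟨G, hG, hGE.trans h, hx⟩

theorem le_contractFun (s : StarOperation T L) (E : NonzeroFractionalIdeal R L) :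
    E ≤ s.contractFun E := fun _ hx =>
  let ⟨F, hF, hFE, hxF⟩ := E.exists_fg_le_mem hx
  ⟨F, hF, hFE, s.contractRel_of_mem hxF⟩

theorem scale_contractFun_le (s : StarOperation T L) {a : L} (ha : a ≠ 0)
    (E : NonzeroFractionalIdeal R L) :
    (s.contractFun E).scale a ha ≤ s.contractFun (E.scale a ha) := by
  intro y hy
  obtain ⟨x, ⟨F, hF, hFE, hx⟩, rfl⟩ := mem_scale.1 hy
  refine ⟨F.scale a ha, hF.scale a ha, scale_mono ha hFE, ?_, fun z hz h => ?_⟩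
  · refine s.mono _ _ (extend_scale_le ha F) ?_
    rw [s.map_scale]
    exact mem_scale.2 ⟨x, hx.1, rfl⟩
  · have h := scale_mono (inv_ne_zero ha) h
    rw [scale_inv_scale, scale_scale] at h
    have h := (mem_scale (ha := ha)).2 ⟨x, hx.2 _ _ h, rfl⟩
    rwa [← scale_scale (inv_ne_zero ha) hz, scale_scale_inv] at h

/-- The union defining `contractFun` is directed, so a finitely generated ideal inside it lies in
one of its terms. -/
theorem exists_le_contractFun_of_fg {s : StarOperation T L} {E F : NonzeroFractionalIdeal R L}
    (hF : F.FG) (h : F ≤ s.contractFun E) :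
    ∃ G : NonzeroFractionalIdeal R L, G.FG ∧ G ≤ E ∧ F ≤ s.contractFun G := by
  classical
  obtain ⟨S, hS⟩ := hF
  have key : ∀ S : Finset L, (∀ x ∈ S, x ∈ (s.contractFun E).1) →
      ∃ G : NonzeroFractionalIdeal R L, G.FG ∧ G ≤ E ∧ ∀ x ∈ S, x ∈ (s.contractFun G).1 := by
    intro S
    induction S using Finset.induction_on with
    | empty =>
      intro _
      obtain ⟨G, hG, hGE, -⟩ := E.exists_fg_le_mem (Submodule.zero_mem E.1.1)
      exact ⟨G, hG, hGE, by simp⟩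
    | insert a S _ ih =>
      intro hS
      obtain ⟨G, hG, hGE, hGS⟩ := ih fun x hx => hS x (Finset.mem_insert_of_mem hx)
      obtain ⟨H, hH, hHE, hHa⟩ := hS a (Finset.mem_insert_self a S)
      obtain ⟨I, hI, hIE, hGI, hHI⟩ := exists_fg_sup hG hH hGE hHE
      refine ⟨I, hI, hIE, fun x hx => ?_⟩
      obtain rfl | hx := Finset.mem_insert.1 hx
      · exact ⟨H, hH, hHI, hHa⟩
      · exact s.contractFun_mono hGI (hGS x hx)
  obtain ⟨G, hG, hGE, hGS⟩ := key S fun x hx => h (by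
    rw [← FractionalIdeal.mem_coe, ← hS]
    exact Submodule.subset_span hx)
  refine ⟨G, hG, hGE, fun x hx => ?_⟩
  have hle : Submodule.span R (S : Set L) ≤ (s.contractFun G).1.1 := Submodule.span_le.2 hGS
  rw [hS] at hle
  exact hle hx

variable (R) in
/-- The star operation `E ↦ ⋃ ((FT)^* ∩ F_v)` induced on `R` by a star operation of an overring
`T`; here `F` runs over the finitely generated fractional ideals contained in `E`. -/
def contract (s : StarOperation T L) : StarOperation R L where
  toFun := s.contractFun
  map_unit := by
    refine le_antisymm ?_ (s.le_contractFun _)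
    rintro x ⟨F, -, hFE, hx⟩
    have h := hx.2 1 one_ne_zero (hFE.trans_eq (scale_one _).symm)
    rwa [scale_one] at h
  map_scale a ha E := by
    refine le_antisymm ?_ (s.scale_contractFun_le ha E)
    have h := scale_mono ha (s.scale_contractFun_le (inv_ne_zero ha) (E.scale a ha))
    rwa [scale_scale_inv, scale_inv_scale] at h
  le_map := s.le_contractFun
  mono _ _ := s.contractFun_mono
  idem E := by
    refine le_antisymm ?_ (s.le_contractFun _)
    rintro x ⟨F, hF, hFE, hx⟩
    obtain ⟨G, hG, hGE, hFG⟩ := exists_le_contractFun_of_fg hF hFE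
    refine ⟨G, hG, hGE, ?_, fun z hz hGz => hx.2 z hz fun y hy =>
      ((mem_contractFun_of_fg hG).1 (hFG hy)).2 z hz hGz⟩
    rw [← s.idem]
    exact s.mono _ _ (extend_le_iff.2 fun y hy =>
      ((mem_contractFun_of_fg hG).1 (hFG hy)).1) hx.1

theorem contract_isFiniteType (s : StarOperation T L) : (s.contract R).IsFiniteType :=
  fun _ _ => ⟨fun ⟨F, hF, hFE, hx⟩ => ⟨F, hF, hFE, F, hF, le_rfl, hx⟩,
    fun ⟨_, _, hFE, hx⟩ => s.contractFun_mono hFE hx⟩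

variable (R) in
/-- Contraction loses nothing on `J^*` if `J` is extended from a finitely generated `G` that is so
large that `J^*` lies in all principal fractional ideals of `R` containing `G`. If every finitely
generated `J` has such a `G` for every star operation, contraction is injective. -/
theorem contract_injOn
    (h : ∀ J : NonzeroFractionalIdeal T L, J.FG → ∃ G : NonzeroFractionalIdeal R L, G.FG ∧
      G.extend T = J ∧ ∀ (s : StarOperation T L) (z : L) (hz : z ≠ 0), G ≤ unit.scale z hz →
        ∀ x ∈ (s.toFun J).1, x ∈ (unit.scale z hz : NonzeroFractionalIdeal R L).1) :
    Set.InjOn (contract R) (StarFC T L) := by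
  have key (s t : StarOperation T L) (hst : s.contract R = t.contract R)
      (J : NonzeroFractionalIdeal T L) (hJ : J.FG) : s.toFun J ≤ t.toFun J := by
    obtain ⟨G, hG, rfl, hGs⟩ := h J hJ
    intro x hx
    have h1 : x ∈ ((s.contract R).toFun G).1 :=
      (mem_contractFun_of_fg hG).2 ⟨hx, fun z hz hz' => hGs s z hz hz' x hx⟩
    rw [hst] at h1
    exact ((mem_contractFun_of_fg hG).1 h1).1
  exact fun s hs t ht hst => hs.ext_fg ht (key s t hst) (key t s hst.symm)

end StarOperation

/-! ### Pseudo-valuation domains -/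

section PseudoValuationDomain

open NonzeroFractionalIdeal StarOperation

variable {R L : Type*} [CommRing R] [IsDomain R] [Field L] [Algebra R L] [IsFractionRing R L]

/-- With respect to a valuation ring `V`, one of finitely many generators of a fractional ideal `J`
has largest value, and it divides the others in `V`. -/
theorem NonzeroFractionalIdeal.FG.exists_generator {J : NonzeroFractionalIdeal R L} (hJ : J.FG)
    (V : ValuationSubring L) :
    ∃ S : Finset L, (∀ x ∈ S, x ∈ J.1) ∧
      (∀ I : NonzeroFractionalIdeal R L, (∀ x ∈ S, x ∈ I.1) → J ≤ I) ∧
      ∃ a ∈ S, a ≠ 0 ∧ ∀ b ∈ S, ∃ v ∈ V, b = a * v := by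
  obtain ⟨S, hS⟩ := hJ
  have hSJ : ∀ x ∈ S, x ∈ J.1 := fun x hx => by
    rw [← FractionalIdeal.mem_coe, ← hS]
    exact Submodule.subset_span hx
  have hS0 : ∃ x ∈ S, x ≠ 0 := by
    by_contra! h
    have h0 : Submodule.span R (S : Set L) = ⊥ := Submodule.span_eq_bot.2 h
    obtain ⟨x, hx, hx0⟩ := J.exists_mem_ne_zero
    rw [← FractionalIdeal.mem_coe, ← hS, h0] at hx
    exact hx0 hx
  refine ⟨S, hSJ, fun I hI x hx => ?_, ?_⟩
  · rw [← FractionalIdeal.mem_coe, ← hS] at hx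
    exact (Submodule.span_le (p := (I.1 : Submodule R L))).2 hI hx
  · obtain ⟨x, hx, hx0⟩ := hS0
    obtain ⟨a, ha, hmax⟩ := S.exists_max_image V.valuation ⟨x, hx⟩
    have ha0 : a ≠ 0 := by
      rintro rfl
      have := hmax x hx
      rw [map_zero, le_zero_iff, map_eq_zero] at this
      exact hx0 this
    refine ⟨a, ha, ha0, fun b hb => ⟨b / a, ?_, by field_simp⟩⟩
    rw [← V.valuation_le_one_iff, map_div₀]
    exact div_le_one_of_le₀ (hmax b hb) zero_le

/-- Over an overring `T` of a valuation ring, finitely generated fractional ideals are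
principal. -/
theorem starFC_subsingleton_of_valuationSubring_le (V : ValuationSubring L) (T : Subalgebra R L)
    (hVT : ∀ v ∈ V, v ∈ T) : (StarFC T L).Subsingleton := by
  refine starFC_subsingleton fun J hJ => ?_
  obtain ⟨S, hSJ, hJS, a, haS, ha, hdvd⟩ := hJ.exists_generator V
  refine ⟨a, ha, le_antisymm (hJS _ fun b hb => ?_) fun x hx => ?_⟩
  · obtain ⟨v, hv, rfl⟩ := hdvd b hb
    exact mem_unit_scale.2 ⟨⟨v, hVT v hv⟩, rfl⟩
  · obtain ⟨t, rfl⟩ := mem_unit_scale.1 hx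
    have := Submodule.smul_mem J.1.1 t (hSJ a haS)
    rwa [Algebra.smul_def, mul_comm] at this

/-- If the maximal ideal `M` of `V` lies in `T` but `V` does not, then `V = (T : M)`, so `aV` is an
intersection of principal fractional ideals of `T` and contains `J^*` whenever it contains `J`. -/
theorem StarOperation.exists_eq_mul_of_mem {T : Subalgebra R L} (s : StarOperation T L)
    {V : ValuationSubring L} (hMT : ∀ x, V.valuation x < 1 → x ∈ T) (hVT : ¬ ∀ v ∈ V, v ∈ T)
    {J : NonzeroFractionalIdeal T L} {S : Set L}
    (hJS : ∀ I : NonzeroFractionalIdeal T L, (∀ x ∈ S, x ∈ I.1) → J ≤ I) {a : L} (ha : a ≠ 0)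
    (hdvd : ∀ b ∈ S, ∃ v ∈ V, b = a * v) {x : L} (hx : x ∈ (s.toFun J).1) :
    ∃ v ∈ V, x = a * v := by
  refine ⟨x / a, ?_, by field_simp⟩
  by_contra hxa
  refine hVT fun v hv => ?_
  have hx0 : x ≠ 0 := by
    rintro rfl
    exact hxa (by simp)
  obtain rfl | hv0 := eq_or_ne v 0
  · exact zero_mem T
  have hinv : V.valuation (a / x) < 1 := by
    rw [← V.valuation_le_one_iff, not_le] at hxa
    rw [← inv_div, map_inv₀]
    exact inv_lt_one_of_one_lt₀ hxa
  -- `m = v(a/x)` lies in `M`, so `mJ ⊆ aT`; hence `mx = va` lies in `aT`, and `v` in `T`.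
  have hM : ∀ w ∈ V, V.valuation (v * (a / x) * w) < 1 := fun w hw => by
    rw [map_mul, map_mul, mul_right_comm]
    exact mul_lt_one_of_nonneg_of_lt_one_right
      (mul_le_one₀ ((V.valuation_le_one_iff v).2 hv) zero_le
        ((V.valuation_le_one_iff w).2 hw)) zero_le hinv
  set m := v * (a / x) with hm
  have hm0 : m ≠ 0 := mul_ne_zero hv0 (div_ne_zero ha hx0)
  have hJ : J ≤ unit.scale (m⁻¹ * a) (mul_ne_zero (inv_ne_zero hm0) ha) := by
    refine hJS _ fun b hb => ?_
    obtain ⟨w, hw, rfl⟩ := hdvd b hb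
    refine mem_unit_scale.2 ⟨⟨m * w, hMT _ (hM w hw)⟩, ?_⟩
    change a * w = m⁻¹ * a * (m * w)
    field_simp
  obtain ⟨t, ht⟩ := mem_unit_scale.1 (s.map_le_unit_scale hJ hx)
  have hvt : v = (t : L) := by
    change x = m⁻¹ * a * (t : L) at ht
    have h1 : m * x = a * (t : L) := by
      rw [ht]
      field_simp
    have h2 : m * x = a * v := by
      rw [hm]
      field_simp
    exact mul_left_cancel₀ ha (h2.symm.trans h1)
  rw [hvt]
  exact t.2

/-- Generators of `J` over `T` together with further elements of `J` span a fractional ideal of `R`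
that extends to `J`. -/
theorem NonzeroFractionalIdeal.exists_extend_eq {T : Subalgebra R L}
    {J : NonzeroFractionalIdeal T L} {S : Finset L} (hSJ : ∀ x ∈ S, x ∈ J.1)
    (hJS : ∀ I : NonzeroFractionalIdeal T L, (∀ x ∈ S, x ∈ I.1) → J ≤ I) (hS : ∃ x ∈ S, x ≠ 0) :
    ∃ G : NonzeroFractionalIdeal R L, G.FG ∧ G.extend T = J ∧ ∀ x ∈ S, x ∈ G.1 := by
  have hsub : ∀ x ∈ S, x ∈ Submodule.span R (S : Set L) := fun x hx => Submodule.subset_span hx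
  obtain ⟨y, hy, hy0⟩ := hS
  refine ⟨ofFG (Submodule.span R (S : Set L)) (Submodule.fg_span S.finite_toSet)
    ⟨y, hsub y hy, hy0⟩, fg_ofFG _ _ _, le_antisymm (extend_le_iff.2 ?_)
    (hJS _ fun x hx => mem_extend_of_mem (hsub x hx)), hsub⟩
  have hle : Submodule.span R (S : Set L) ≤ (J.1 : Submodule T L).restrictScalars R :=
    Submodule.span_le.2 hSJ
  exact hle

/-- For an overring `T` of a pseudo-valuation domain `R` that does not contain the valuation ring
`V`, contraction embeds `StarFC T L` into `StarFC R L`. The proof adds a suitable element of `J` to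
the generators of a finitely generated `J`, unless `T = R`. -/
theorem contract_injOn_of_not_valuationSubring_le [IsLocalRing R] {V : ValuationSubring L}
    (hV : ∀ x : L, V.valuation x < 1 ↔ ∃ r ∈ IsLocalRing.maximalIdeal R, algebraMap R L r = x)
    (T : Subalgebra R L) (hVT : ¬ ∀ v ∈ V, v ∈ T) :
    Set.InjOn (contract R) (StarFC T L) := by
  have hMT : ∀ x, V.valuation x < 1 → x ∈ T := fun x hx => by
    obtain ⟨r, -, rfl⟩ := (hV x).1 hx
    exact T.algebraMap_mem r
  refine contract_injOn R fun J hJ => ?_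
  obtain ⟨S, hSJ, hJS, a, haS, ha, hdvd⟩ := hJ.exists_generator V
  by_cases hT : ∀ t ∈ T, ∃ r, algebraMap R L r = t
  · obtain ⟨G, hG, hGJ, -⟩ := NonzeroFractionalIdeal.exists_extend_eq hSJ hJS ⟨a, haS, ha⟩
    refine ⟨G, hG, hGJ, fun s z hz hGz x hx => ?_⟩
    have hJz : J ≤ unit.scale z hz := by
      rw [← hGJ]
      refine extend_le_iff.2 fun y hy => ?_
      obtain ⟨r, rfl⟩ := mem_unit_scale.1 (hGz hy)
      exact mem_unit_scale.2 ⟨algebraMap R T r, rfl⟩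
    obtain ⟨t, rfl⟩ := mem_unit_scale.1 (s.map_le_unit_scale hJz hx)
    obtain ⟨r, hr⟩ := hT t t.2
    exact mem_unit_scale.2 ⟨r, by rw [hr]; rfl⟩
  · push Not at hT
    obtain ⟨y, hyT, hyR⟩ := hT
    classical
    -- Adjoining `ya` makes every principal ideal `zR` that contains the generators contain `aV`:
    -- if `a/z` were a unit of `R`, then `y` would lie in `R`; so `a/z` lies in the maximal ideal.
    have hyaJ : y * a ∈ J.1 := Submodule.smul_mem J.1.1 (⟨y, hyT⟩ : T) (hSJ a haS)
    obtain ⟨G, hG, hGJ, hSG⟩ := NonzeroFractionalIdeal.exists_extend_eq (R := R)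
      (S := insert (y * a) S) (fun x hx => (Finset.mem_insert.1 hx).elim (· ▸ hyaJ) (hSJ x))
      (fun I hI => hJS I fun x hx => hI x (Finset.mem_insert_of_mem hx))
      ⟨a, Finset.mem_insert_of_mem haS, ha⟩
    refine ⟨G, hG, hGJ, fun s z hz hGz x hx => ?_⟩
    obtain ⟨v, hv, rfl⟩ := s.exists_eq_mul_of_mem hMT hVT (S := S) hJS ha hdvd hx
    obtain ⟨r, hr⟩ := mem_unit_scale.1 (hGz (hSG a (Finset.mem_insert_of_mem haS)))
    obtain ⟨q, hq⟩ := mem_unit_scale.1 (hGz (hSG (y * a) (Finset.mem_insert_self _ _)))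
    have hyr : y * algebraMap R L r = algebraMap R L q := by
      rw [hr, mul_left_comm] at hq
      exact mul_left_cancel₀ hz hq
    have hrM : r ∈ IsLocalRing.maximalIdeal R := by
      rw [IsLocalRing.mem_maximalIdeal, mem_nonunits_iff]
      rintro ⟨u, rfl⟩
      refine hyR (q * ↑u⁻¹) ?_
      rw [map_mul, ← hyr, mul_assoc, ← map_mul, Units.mul_inv, map_one, mul_one]
    have hrv : V.valuation (algebraMap R L r * v) < 1 := by
      rw [map_mul]
      exact mul_lt_one_of_nonneg_of_lt_one_left zero_le ((hV _).2 ⟨r, hrM, rfl⟩)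
        ((V.valuation_le_one_iff v).2 hv)
    obtain ⟨p, -, hp⟩ := (hV _).1 hrv
    exact mem_unit_scale.2 ⟨p, by rw [hp, hr, mul_assoc]⟩

end PseudoValuationDomain

theorem mainTheorem3 (R L : Type*) [CommRing R] [IsDomain R] [Field L] [Algebra R L]
    [IsFractionRing R L] (hR : IsPseudoValuationDomain R L) :
    IsFinitelyStarRegular R L := by
  obtain ⟨_, V, hRV⟩ := hR
  have hV (x : L) :
      V.valuation x < 1 ↔ ∃ r ∈ IsLocalRing.maximalIdeal R, algebraMap R L r = x := by
    change _ ↔ x ∈ algebraMap R L '' (IsLocalRing.maximalIdeal R : Set R)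
    rw [hRV]
    constructor
    · intro hx
      exact ⟨⟨x, (V.valuation_le_one_iff x).1 hx.le⟩, (V.valuation_lt_one_iff _).2 hx, rfl⟩
    · rintro ⟨w, hw, rfl⟩
      exact (V.valuation_lt_one_iff w).1 hw
  intro T
  by_cases hVT : ∀ v ∈ V, v ∈ T
  · exact (Set.encard_le_one_iff_subsingleton.2
      (starFC_subsingleton_of_valuationSubring_le V T hVT)).trans
      (Set.one_le_encard_iff_nonempty.2 (StarOperation.starFC_nonempty R L))
  · exact Set.encard_le_encard_of_injOn (fun s _ => s.contract_isFiniteType)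
      (contract_injOn_of_not_valuationSubring_le hV T hVT)
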